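/- Let $\mathcal A$ be an abelian category with enough injectives. **Conventions.** Complexes are cochain complexes indexed by $\mathbb Z$; $\mathrm C(\mathcal A)$ is the category of complexes in $\mathcal A$ and $\mathrm C^{[0}(\mathcal A)$ its full subcategory of complexes $X$ with $X^i=0$ for $i<0$. A double complex $K=(K^{i,j})_{i,j\in\mathbb Z}$ has vertical differentials $\partial:K^{i,j}\to K^{i+1,j}$ and horizontal differentials $d:K^{i,j}\to K^{i,j+1}$ with $\partial\partial=0$, $dd=0$, $d\partial=\partial d$; its $i$th row is the complex $K^{i,*}$, and $K$ is viewed as a complex with values in $\mathrm C(\mathcal A)$ with entry $K^{i,*}$ at position $i$. It is a first quadrant double complex if $K^{i,j}=0$ whenever $i<0$ or $j<0$. Write $\mathrm H^0(K^{*,-})\in\mathrm C(\mathcal A)$ for the complex with entry $\mathrm H^0(K^{*,j})$ (the cohomology of the $j$th column) at position $j$. *Cartan–Eilenberg resolutions.* A short exact sequence in $\mathrm C(\mathcal A)$ is pure if all connecting morphisms in its long exact homology sequence vanish. A pure monomorphism (pure epimorphism) is the first (second) morphism of a pure short exact sequence, and a pure morphism is a composite of a pure epimorphism followed by a pure monomorphism.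 An object $I$ of $\mathrm C(\mathcal A)$ is relatively injective if $\mathrm{Hom}(-,I)$ maps pure short exact sequences to short exact sequences. A CE-resolution of $X\in\mathrm C(\mathcal A)$ is a double complex $J$ with $J^{i,*}=0$ for $i<0$ such that there exists a quasi-isomorphism, of complexes with values in $\mathrm C(\mathcal A)$, from $X$ concentrated in row $0$ to $J$ consisting of pure monomorphisms, where moreover all rows $J^{i,*}$ are relatively injective and all vertical differentials $J^{i,*}\to J^{i+1,*}$ are pure. Let $\mathrm{CC}^{\llcorner,\mathrm{CE}}(\mathrm{Inj}\,\mathcal A)$ be the full subcategory of first quadrant double complexes that are CE-resolutions of some complex. Given a morphism $f:X\to X'$ in $\mathrm C^{[0}(\mathcal A)$ and first quadrant double complexes $J$, $J'$ that are CE-resolutions of $X$ and $X'$ respectively, a morphism $\hat f:J\to J'$ is called a CE-resolution of $f$ if $\mathrm H^0(\hat f^{*,-})$ is isomorphic to $f$ as an arrow of $\mathrm C(\mathcal A)$. *Homotopisms.* A morphism of complexes is a homotopism if its image in the homotopy category is an isomorphism. A morphism $g:K\to L$ of double complexes is a rowwise homotopism if $g^{i,*}:K^{i,*}\to L^{i,*}$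 is a homotopism for every $i\in\mathbb Z$. A double complex is vertically split acyclic if it is isomorphic to one with $i$th row $T^i\oplus T^{i+1}$, for some family $(T^i)_{i\in\mathbb Z}$ of complexes, and with vertical differential mapping the summand $T^{i+1}$ of row $i$ identically to the summand $T^{i+1}$ of row $i+1$ and the summand $T^i$ to zero; horizontally split acyclic double complexes are defined in the same way with rows and columns exchanged; and a double complex is split acyclic if it is isomorphic to the direct sum of a horizontally and a vertically split acyclic one. A double homotopism is a morphism of double complexes that becomes an isomorphism in the quotient category of double complexes in which two parallel morphisms are identified if their difference factors over a split acyclic double complex. **Proposition.** Let $f:X\to X'$ be a quasi-isomorphism in $\mathrm C^{[0}(\mathcal A)$, and let $\hat f:J\to J'$ be a CE-resolution of $f$. Then there exist an object $K$ of $\mathrm{CC}^{\llcorner,\mathrm{CE}}(\mathrm{Inj}\,\mathcal A)$, a rowwise homotopism $g:J\to K$ and a double homotopism $h:K\to J'$ such that $\hat f$ is equal to $g$ followed by $h$. -/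

import Mathlib

open CategoryTheory CategoryTheory.Limits

universe v u

noncomputable section

namespace CartanEilenberg

/-! ### Quotient of an additive category by a class of objects -/

section Quotient

variable {C : Type u} [Category.{v} C] [Preadditive C]

/-- Two parallel morphisms are identified in the quotient `C / P` when their difference factors over
an object satisfying `P`. -/
def factorRel (P : ObjectProperty C) : HomRel C := fun X Y f g =>
  ∃ (S : C) (_ : P S) (a : X ⟶ S) (b : S ⟶ Y), a ≫ b = f - g

/-- The quotient category `C / P`: same objects as `C`, morphisms taken modulo `factorRel P`. -/
abbrev QuotientBy (P : ObjectProperty C) := CategoryTheory.Quotient (factorRel P)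

/-- The residue class functor `C ⥤ C / P`. -/
abbrev residueClassFunctor (P : ObjectProperty C) : C ⥤ QuotientBy P :=
  CategoryTheory.Quotient.functor (factorRel P)

/-- The complex with entry `T j ⊞ T (j + 1)` at position `j`, whose differential maps the second
summand `T (j + 1)` at position `j` identically to the first summand `T (j + 1)` at position
`j + 1`. It is the direct sum, over `j`, of the complexes `T (j + 1) = T (j + 1)` in positions
`j` and `j + 1`. -/
def splitAcyclicOf [HasBinaryBiproducts C] (T : ℤ → C) : CochainComplex C ℤ :=
  CochainComplex.of (fun j => T j ⊞ T (j + 1)) (fun _ => biprod.snd ≫ biprod.inl) (by simp)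

end Quotient

variable {A : Type u} [Category.{v} A] [Abelian A]

/-! ### Double complexes -/

variable (A) in
/-- Double complexes with entries in `A`, with commuting differentials. For `K : DoubleComplex A`,
the complex `K.X i` is the `i`-th row `K^{i,*}`, and `(K.X i).X j` is the entry `K^{i,j}`. The
differential `K.d` is the vertical one, raising `i`. -/
abbrev DoubleComplex := HomologicalComplex₂ A (ComplexShape.up ℤ) (ComplexShape.up ℤ)

/-- A double complex is a first quadrant double complex if its entry at `(i, j)` is zero whenever
`i < 0` or `j < 0`. -/
def IsFirstQuadrant (K : DoubleComplex A) : Prop :=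
  ∀ i j : ℤ, (i < 0 ∨ j < 0) → IsZero ((K.X i).X j)

/-- A morphism of complexes is a homotopism if it becomes an isomorphism in the homotopy
category. -/
def IsHomotopism {X Y : CochainComplex A ℤ} (f : X ⟶ Y) : Prop :=
  IsIso ((HomotopyCategory.quotient A (ComplexShape.up ℤ)).map f)

/-- A morphism of double complexes is a rowwise homotopism if `f^{i,*}` is a homotopism for
all `i`. -/
def IsRowwiseHomotopism {K L : DoubleComplex A} (f : K ⟶ L) : Prop :=
  ∀ i : ℤ, IsHomotopism (f.f i)

/-- Vertically split acyclic double complexes: those isomorphic to a double complex with rows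
`T i ⊞ T (i + 1)` and vertical differential mapping the second summand of row `i` identically to the
first summand of row `i + 1`. -/
def IsVerticallySplitAcyclic (K : DoubleComplex A) : Prop :=
  ∃ T : ℤ → CochainComplex A ℤ, Nonempty (K ≅ splitAcyclicOf T)

/-- Horizontally split acyclic double complexes: the same with the roles of rows and columns
exchanged, so that `T j` are now column complexes. -/
def IsHorizontallySplitAcyclic (K : DoubleComplex A) : Prop :=
  ∃ T : ℤ → CochainComplex A ℤ, Nonempty (K ≅ HomologicalComplex₂.flip (splitAcyclicOf T))

variable (A) in
/-- Split acyclic double complexes: those isomorphic to the direct sum of a horizontally and a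
vertically split acyclic double complex. -/
def splitAcyclic : ObjectProperty (DoubleComplex A) := fun K =>
  ∃ H V : DoubleComplex A, IsHorizontallySplitAcyclic H ∧ IsVerticallySplitAcyclic V ∧
    Nonempty (K ≅ H ⊞ V)

/-- A double homotopism is a morphism of double complexes that becomes an isomorphism in the
quotient of the category of double complexes by the split acyclic ones. -/
def IsDoubleHomotopism {K L : DoubleComplex A} (f : K ⟶ L) : Prop :=
  IsIso ((residueClassFunctor (splitAcyclic A)).map f)

/-! ### The exact structure on complexes, and Cartan-Eilenberg resolutions -/

/-- A short exact sequence of complexes is pure if all connecting morphisms in its long exact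
homology sequence are zero. -/
def IsPureShortExact (S : ShortComplex (CochainComplex A ℤ)) : Prop :=
  ∃ hS : S.ShortExact, ∀ (i j : ℤ) (hij : (ComplexShape.up ℤ).Rel i j), hS.δ i j hij = 0

/-- Pure monomorphisms: the first morphisms of pure short exact sequences. -/
def IsPureMono {X Y : CochainComplex A ℤ} (f : X ⟶ Y) : Prop :=
  ∃ (Z : CochainComplex A ℤ) (g : Y ⟶ Z) (w : f ≫ g = 0), IsPureShortExact (ShortComplex.mk f g w)

/-- Pure epimorphisms: the second morphisms of pure short exact sequences. -/
def IsPureEpi {Y Z : CochainComplex A ℤ} (g : Y ⟶ Z) : Prop :=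
  ∃ (X : CochainComplex A ℤ) (f : X ⟶ Y) (w : f ≫ g = 0), IsPureShortExact (ShortComplex.mk f g w)

/-- Pure morphisms: composites of a pure epimorphism, followed by a pure monomorphism. -/
def IsPure {X Y : CochainComplex A ℤ} (f : X ⟶ Y) : Prop :=
  ∃ (Z : CochainComplex A ℤ) (p : X ⟶ Z) (i : Z ⟶ Y), IsPureEpi p ∧ IsPureMono i ∧ p ≫ i = f

/-- A complex `I` is relatively injective if `Hom(-, I)` maps pure short exact sequences to short
exact sequences. As `Hom(-, I)` is left exact, this means that morphisms to `I` extend along pure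
monomorphisms. -/
def IsRelativelyInjective (I : CochainComplex A ℤ) : Prop :=
  ∀ ⦃X Y : CochainComplex A ℤ⦄ (m : X ⟶ Y), IsPureMono m →
    ∀ g : X ⟶ I, ∃ h : Y ⟶ I, m ≫ h = g

/-- The double complex `J` is a Cartan-Eilenberg resolution of the complex `X`: its rows are zero in
negative degrees, and there is a quasi-isomorphism to `J` from `X`, concentrated in row `0`
(as complexes with values in the category of complexes), such that the rows of `J` are
relatively injective, the differentials between the rows are pure, and the quasi-isomorphism
consists of pure monomorphisms. -/
def IsCEResolution (X : CochainComplex A ℤ) (J : DoubleComplex A) : Prop :=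
  (∀ i : ℤ, i < 0 → IsZero (J.X i)) ∧
  (∀ i : ℤ, IsRelativelyInjective (J.X i)) ∧
  (∀ i : ℤ, IsPure (J.d i (i + 1))) ∧
  ∃ ε : (HomologicalComplex.single (CochainComplex A ℤ) (ComplexShape.up ℤ) 0).obj X ⟶ J,
    QuasiIso ε ∧ ∀ i : ℤ, IsPureMono (ε.f i)

variable (A) in
/-- The objects of the full subcategory, in first quadrant double complexes, of Cartan-Eilenberg
resolutions (of some complex). -/
def ceResolutions : ObjectProperty (DoubleComplex A) := fun J =>
  IsFirstQuadrant J ∧ ∃ X : CochainComplex A ℤ, IsCEResolution X J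

/-- A morphism `fhat : J ⟶ J'` between first quadrant double complexes is a Cartan-Eilenberg
resolution of `f : X ⟶ X'` if `J` and `J'` are Cartan-Eilenberg resolutions of `X` and `X'`, and if
the morphism induced by `fhat` on the zeroth homology in the vertical direction is isomorphic to `f`,
as an arrow in the category of complexes. Here `J.homology 0` is the homology of `J` as a complex
with values in complexes; its entry at `j` is the zeroth homology of the column `J^{*,j}`. -/
def IsCEResolutionOfMorphism {X X' : CochainComplex A ℤ} (f : X ⟶ X')
    {J J' : DoubleComplex A} (fhat : J ⟶ J') : Prop :=
  (IsFirstQuadrant J ∧ IsCEResolution X J) ∧ (IsFirstQuadrant J' ∧ IsCEResolution X' J') ∧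
  Nonempty (Arrow.mk (HomologicalComplex.homologyMap fhat 0) ≅ Arrow.mk f)

end CartanEilenberg

end

noncomputable section

namespace CartanEilenberg

variable {A : Type u} [Category.{v} A] [Abelian A]

/-! ### Purity expressed through homology. -/

open HomologicalComplex

/-! Write Z^i for vertical cycles. Rows in negative positions vanish, so Z^0 is the zeroth vertical
homology and `fhat` induces a quasi-isomorphism Z^0(J) → Z^0(J'). The double complex K is built row
by row as a CE-resolution of M^0 = Z^0(J').

Given a quasi-isomorphism φ : Z^i(J) → M^i, form its pushout along the pure monomorphism Z^i(J) →
J^i. The map from J^i to the pushout is again a quasi-isomorphism, so the pushout has injective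
homology and embeds by a quasi-isomorphism into a relatively injective complex K^i
(`exists_square`). With M^{i+1} = K^i / M^i, comparing short exact sequences gives the next φ
(`Stage.exists_row`). The weak universality of the square yields K^i → J'^i compatible with `fhat`.

Each J^i → K^i is a quasi-isomorphism between bounded below complexes of injectives, hence a
homotopism. The map K → J' is an isomorphism on Z^0, so it compares two relatively injective
resolutions of the same complex: its mapping cone is contractible
(`isDoubleHomotopism_of_isIso_cyclesMap`), and null-homotopic morphisms factor over vertically split
acyclic double complexes (`factorRel_of_homotopy`). -/

lemma isPureShortExact_iff {S : ShortComplex (CochainComplex A ℤ)} (hS : S.ShortExact) :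
    IsPureShortExact S ↔ ∀ i, Mono (homologyMap S.f i) := by
  constructor
  · rintro ⟨hS', h⟩ j
    exact (hS'.homology_exact₁ (j - 1) j (by simp)).mono_g (h _ _ _)
  · intro h
    refine ⟨hS, fun i j hij => ?_⟩
    have := h j
    rw [← cancel_mono (homologyMap S.f j), hS.δ_comp, zero_comp]

lemma shortExact_cokernel {C : Type*} [Category* C] [Abelian C] {X Y : C} (f : X ⟶ Y) [Mono f] :
    (ShortComplex.mk f (cokernel.π f) (cokernel.condition f)).ShortExact where
  exact := ShortComplex.exact_of_g_is_cokernel _ (cokernelIsCokernel f)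

lemma isPureMono_iff {X Y : CochainComplex A ℤ} (f : X ⟶ Y) :
    IsPureMono f ↔ Mono f ∧ ∀ i, Mono (homologyMap f i) := by
  constructor
  · rintro ⟨Z, g, w, h⟩
    obtain ⟨hS, _⟩ := id h
    exact ⟨hS.mono_f, (isPureShortExact_iff hS).1 h⟩
  · rintro ⟨_, h⟩
    exact ⟨_, _, _, (isPureShortExact_iff (shortExact_cokernel f)).2 h⟩

lemma IsPureMono.mono {X Y : CochainComplex A ℤ} {f : X ⟶ Y} (hf : IsPureMono f) : Mono f :=
  ((isPureMono_iff f).1 hf).1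

lemma IsPureMono.mono_f {X Y : CochainComplex A ℤ} {f : X ⟶ Y} (hf : IsPureMono f) (i : ℤ) :
    Mono (f.f i) :=
  have := hf.mono
  inferInstance

lemma IsPureMono.mono_homologyMap {X Y : CochainComplex A ℤ} {f : X ⟶ Y} (hf : IsPureMono f)
    (i : ℤ) : Mono (homologyMap f i) :=
  ((isPureMono_iff f).1 hf).2 i

lemma IsPureMono.comp {X Y Z : CochainComplex A ℤ} {f : X ⟶ Y} {g : Y ⟶ Z} (hf : IsPureMono f)
    (hg : IsPureMono g) : IsPureMono (f ≫ g) := by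
  have := hf.mono
  have := hg.mono
  refine (isPureMono_iff _).2 ⟨mono_comp _ _, fun i => ?_⟩
  have := hf.mono_homologyMap i
  have := hg.mono_homologyMap i
  rw [homologyMap_comp]
  exact mono_comp _ _

lemma isPureMono_of_quasiIso {X Y : CochainComplex A ℤ} (f : X ⟶ Y) [Mono f] [QuasiIso f] :
    IsPureMono f :=
  (isPureMono_iff f).2 ⟨inferInstance, inferInstance⟩

lemma isPureMono_of_isZero {X Y : CochainComplex A ℤ} (f : X ⟶ Y) (hX : IsZero X) :
    IsPureMono f :=
  (isPureMono_iff f).2 ⟨⟨fun _ _ _ => hX.eq_of_tgt _ _⟩,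
    fun i => ⟨fun _ _ _ => (((homologyFunctor A _ i).map_isZero hX)).eq_of_tgt _ _⟩⟩

lemma IsPureMono.isPureShortExact {X Y Z : CochainComplex A ℤ} {f : X ⟶ Y} (hf : IsPureMono f)
    (g : Y ⟶ Z) (w : f ≫ g = 0) (h : (ShortComplex.mk f g w).ShortExact) :
    IsPureShortExact (ShortComplex.mk f g w) :=
  (isPureShortExact_iff h).2 hf.mono_homologyMap

/-- The map on cokernels of the incoming differentials induced by a pure monomorphism is a
monomorphism. -/
lemma IsPureMono.mono_opcyclesMap {X Y : CochainComplex A ℤ} {f : X ⟶ Y} (hf : IsPureMono f)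
    (i : ℤ) : Mono (opcyclesMap f i) := by
  have := hf.mono_homologyMap i
  have := hf.mono_f (i + 1)
  have w : ∀ K : CochainComplex A ℤ, K.homologyι i ≫ K.fromOpcycles i (i + 1) = 0 :=
    fun K => by simp
  have ex : ∀ K : CochainComplex A ℤ, (ShortComplex.mk _ _ (w K)).Exact := fun K =>
    ShortComplex.exact_of_f_is_kernel _ (K.homologyIsKernel i (i + 1) (by simp))
  -- Four lemma for 0 → H^i → opcycles → (degree i + 1), where both outer maps are monomorphisms.
  refine ShortComplex.mono_of_mono_of_mono_of_mono (R₁ := ShortComplex.mk _ _ (w X))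
    (R₂ := ShortComplex.mk _ _ (w Y))
    (φ := ShortComplex.homMk (homologyMap f i) (opcyclesMap f i) (f.f (i + 1)) ?_ ?_)
    (ex X) (inferInstanceAs (Mono (Y.homologyι i))) ‹Mono (homologyMap f i)›
      ‹Mono (f.f (i + 1))›
  · simp
  · simp [← cancel_epi (X.pOpcycles i)]

section FiveLemma

open ComposableArrows Abelian HomologySequence

variable {C : Type*} [Category* C] [Abelian C] {S₁ S₂ : ShortComplex (CochainComplex C ℤ)}

lemma quasiIso_middle (φ : S₁ ⟶ S₂) (hS₁ : S₁.ShortExact) (hS₂ : S₂.ShortExact)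
    (h₁ : QuasiIso φ.τ₁) (h₃ : QuasiIso φ.τ₃) : QuasiIso φ.τ₂ := by
  rw [quasiIso_iff]
  intro i
  rw [quasiIsoAt_iff_isIso_homologyMap]
  have hij : (ComplexShape.up ℤ).Rel (i - 1) i := by simp
  have hij' : (ComplexShape.up ℤ).Rel i (i + 1) := by simp
  have e3' : Epi (homologyMap φ.τ₃ (i - 1)) := inferInstance
  have m1 : Mono (homologyMap φ.τ₁ i) := inferInstance
  have m3 : Mono (homologyMap φ.τ₃ i) := inferInstance
  have e1 : Epi (homologyMap φ.τ₁ i) := inferInstance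
  have e3 : Epi (homologyMap φ.τ₃ i) := inferInstance
  have m1' : Mono (homologyMap φ.τ₁ (i + 1)) := inferInstance
  have h1 : Mono (homologyMap φ.τ₂ i) := by
    have := mono_of_epi_of_mono_of_mono
      ((δ₀Functor ⋙ δ₀Functor).map (mapComposableArrows₅ φ hS₁ hS₂ (i - 1) i hij))
      (composableArrows₅_exact hS₁ (i - 1) i (by simp)).δ₀.δ₀
      (composableArrows₅_exact hS₂ (i - 1) i (by simp)).δ₀.δ₀
      e3'
      m1 m3
    exact this
  have h2 : Epi (homologyMap φ.τ₂ i) := by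
    have := epi_of_epi_of_epi_of_mono
      ((δlastFunctor ⋙ δlastFunctor).map (mapComposableArrows₅ φ hS₁ hS₂ i (i + 1) hij'))
      (composableArrows₅_exact hS₁ i (i + 1) (by simp)).δlast.δlast
      (composableArrows₅_exact hS₂ i (i + 1) (by simp)).δlast.δlast
      e1 e3
      m1'
    exact this
  exact isIso_of_mono_of_epi _

end FiveLemma

/-! ### Standard relatively injective complexes -/

/-- The morphism to a complex with zero differentials given by morphisms from the cokernels of the
incoming differentials. -/
@[simps]
def toZeroDiff (P : CochainComplex A ℤ) {N : CochainComplex A ℤ} (hN : ∀ i j, N.d i j = 0)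
    (r : ∀ j, P.opcycles j ⟶ N.X j) : P ⟶ N where
  f j := P.pOpcycles j ≫ r j
  comm' := by simp [hN]

section SplitAcyclic

variable {C : Type*} [Category* C] [Preadditive C] [HasBinaryBiproducts C]

namespace splitAcyclicOf

/-- The projection to the first summand. -/
def fst (T : ℤ → C) (j : ℤ) : (splitAcyclicOf T).X j ⟶ T j :=
  (biprod.fst : T j ⊞ T (j + 1) ⟶ T j)

/-- The projection to the second summand. -/
def snd (T : ℤ → C) (j : ℤ) : (splitAcyclicOf T).X j ⟶ T (j + 1) :=
  (biprod.snd : T j ⊞ T (j + 1) ⟶ T (j + 1))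

/-- Morphisms to an entry of `splitAcyclicOf T`. -/
def lift {W : C} {T : ℤ → C} {j : ℤ} (a : W ⟶ T j) (b : W ⟶ T (j + 1)) :
    W ⟶ (splitAcyclicOf T).X j :=
  (biprod.lift a b : W ⟶ T j ⊞ T (j + 1))

@[simp]
lemma lift_fst {W : C} {T : ℤ → C} {j : ℤ} (a : W ⟶ T j) (b : W ⟶ T (j + 1)) :
    lift a b ≫ fst T j = a := biprod.lift_fst _ _

@[simp]
lemma lift_snd {W : C} {T : ℤ → C} {j : ℤ} (a : W ⟶ T j) (b : W ⟶ T (j + 1)) :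
    lift a b ≫ snd T j = b := biprod.lift_snd _ _

lemma hom_ext {W : C} {T : ℤ → C} {j : ℤ} {x y : W ⟶ (splitAcyclicOf T).X j}
    (h₁ : x ≫ fst T j = y ≫ fst T j) (h₂ : x ≫ snd T j = y ≫ snd T j) : x = y :=
  biprod.hom_ext (X := T j) (Y := T (j + 1)) x y h₁ h₂

lemma d_eq (T : ℤ → C) (j : ℤ) : (splitAcyclicOf T).d j (j + 1) =
    ((biprod.snd : T j ⊞ T (j + 1) ⟶ T (j + 1)) ≫
      (biprod.inl : T (j + 1) ⟶ T (j + 1) ⊞ T (j + 1 + 1))) :=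
  CochainComplex.of_d (fun j => T j ⊞ T (j + 1))
    (fun j => (biprod.snd : T j ⊞ T (j + 1) ⟶ T (j + 1)) ≫ biprod.inl) j

@[simp]
lemma d_fst (T : ℤ → C) (j : ℤ) : (splitAcyclicOf T).d j (j + 1) ≫ fst T (j + 1) = snd T j := by
  rw [d_eq]
  exact (Category.assoc _ _ _).trans ((congrArg (_ ≫ ·) biprod.inl_fst).trans (Category.comp_id _))

@[simp]
lemma d_snd (T : ℤ → C) (j : ℤ) : (splitAcyclicOf T).d j (j + 1) ≫ snd T (j + 1) = 0 := by
  rw [d_eq]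
  exact (Category.assoc _ _ _).trans ((congrArg (_ ≫ ·) biprod.inl_snd).trans comp_zero)

end splitAcyclicOf

open splitAcyclicOf

/-- The morphism to `splitAcyclicOf T` given by a family of morphisms to the objects `T j`. -/
@[simps]
def toSplitAcyclicOf (P : CochainComplex C ℤ) {T : ℤ → C} (a : ∀ j, P.X j ⟶ T j) :
    P ⟶ splitAcyclicOf T where
  f j := lift (a j) (P.d j (j + 1) ≫ a (j + 1))
  comm' i j hij := by
    obtain rfl : i + 1 = j := hij
    apply splitAcyclicOf.hom_ext <;> simp

/-- `splitAcyclicOf T` is cofree: the first components determine a morphism, the second ones being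
forced by the differential. -/
lemma eq_toSplitAcyclicOf {P : CochainComplex C ℤ} {T : ℤ → C} (u : P ⟶ splitAcyclicOf T) :
    u = toSplitAcyclicOf P (fun j => u.f j ≫ fst T j) := by
  ext j
  have h := u.comm j (j + 1) =≫ fst T (j + 1)
  simp only [Category.assoc, d_fst] at h
  exact splitAcyclicOf.hom_ext (by simp) (by simpa only [toSplitAcyclicOf_f, lift_snd] using h)

end SplitAcyclic

open splitAcyclicOf

lemma splitAcyclicOf.exists_comp_d {W : A} {T : ℤ → A} {i : ℤ}
    (x : W ⟶ (splitAcyclicOf T).X (i + 1))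
    (hx : x ≫ (splitAcyclicOf T).d (i + 1) (i + 1 + 1) = 0) :
    ∃ y : W ⟶ (splitAcyclicOf T).X i, x = y ≫ (splitAcyclicOf T).d i (i + 1) := by
  have h := hx =≫ fst T (i + 1 + 1)
  rw [Category.assoc, d_fst, zero_comp] at h
  exact ⟨lift 0 (x ≫ fst T (i + 1)), splitAcyclicOf.hom_ext (by simp) (by simp [h])⟩

lemma splitAcyclicOf_acyclic (T : ℤ → A) : (splitAcyclicOf T).Acyclic := by
  intro j
  obtain ⟨i, rfl⟩ : ∃ i, j = i + 1 := ⟨j - 1, by simp⟩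
  rw [exactAt_iff' _ i (i + 1) (i + 1 + 1) (by simp) (by simp),
    ShortComplex.exact_iff_exact_up_to_refinements]
  intro W x hx
  obtain ⟨y, hy⟩ := splitAcyclicOf.exists_comp_d x hx
  exact ⟨W, 𝟙 _, inferInstance, y, (Category.id_comp _).trans hy⟩

/-- Morphisms to a complex with zero differentials amount to families out of the opcycles, on which
pure monomorphisms stay monic. -/
lemma isRelativelyInjective_of_d_eq_zero (N : CochainComplex A ℤ) (hN : ∀ i j, N.d i j = 0)
    [∀ j, Injective (N.X j)] : IsRelativelyInjective N := by
  intro X Y m hm g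
  have := hm.mono_opcyclesMap
  let a : ∀ j, X.opcycles j ⟶ N.X j := fun j => X.descOpcycles (g.f j) (j - 1) (by simp)
    (by simp [← g.comm, hN])
  refine ⟨toZeroDiff Y hN (fun j => Injective.factorThru (a j) (opcyclesMap m j)), ?_⟩
  ext j
  rw [comp_f, toZeroDiff_f, ← p_opcyclesMap_assoc, Injective.comp_factorThru]
  simp [a]

/-- By cofreeness the extension problem is degreewise, so only monicity in each degree is used. -/
lemma isRelativelyInjective_splitAcyclicOf (T : ℤ → A) [∀ j, Injective (T j)] :
    IsRelativelyInjective (splitAcyclicOf T) := by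
  intro X Y m hm g
  have := hm.mono_f
  refine ⟨toSplitAcyclicOf Y (fun j => Injective.factorThru (g.f j ≫ fst T j) (m.f j)), ?_⟩
  conv_rhs => rw [eq_toSplitAcyclicOf g]
  ext j
  apply splitAcyclicOf.hom_ext <;> simp

lemma IsRelativelyInjective.biprod {I I' : CochainComplex A ℤ} (hI : IsRelativelyInjective I)
    (hI' : IsRelativelyInjective I') : IsRelativelyInjective (I ⊞ I') := by
  intro X Y m hm g
  obtain ⟨h, hh⟩ := hI m hm (g ≫ biprod.fst)
  obtain ⟨h', hh'⟩ := hI' m hm (g ≫ biprod.snd)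
  refine ⟨biprod.lift h h', ?_⟩
  apply biprod.hom_ext <;> simp [hh, hh']

lemma homologyMap_toZeroDiff (P : CochainComplex A ℤ) {N : CochainComplex A ℤ}
    (hN : ∀ i j, N.d i j = 0) (r : ∀ j, P.opcycles j ⟶ N.X j) (j : ℤ) :
    homologyMap (toZeroDiff P hN r) j ≫ N.homologyι j = P.homologyι j ≫ r j ≫ N.pOpcycles j := by
  rw [← cancel_epi (P.homologyπ j)]
  simp

lemma quasiIso_biprod_fst (I D : CochainComplex A ℤ) (hD : D.Acyclic) :
    QuasiIso (biprod.fst : I ⊞ D ⟶ I) := by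
  rw [quasiIso_iff]
  intro i
  rw [quasiIsoAt_iff_isIso_homologyMap]
  have h0 : homologyMap (biprod.snd : I ⊞ D ⟶ D) i = 0 :=
    ((exactAt_iff_isZero_homology _ _).1 (hD i)).eq_of_tgt _ _
  refine ⟨homologyMap biprod.inl i, ?_, by simp [← homologyMap_comp]⟩
  have : homologyMap (𝟙 (I ⊞ D)) i = 𝟙 _ := homologyMap_id _ _
  rw [← biprod.total, homologyMap_add, homologyMap_comp, homologyMap_comp, h0] at this
  simpa using this

lemma isZero_biprod {C : Type*} [Category* C] [Preadditive C] [HasBinaryBiproducts C] {X Y : C}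
    (hX : IsZero X) (hY : IsZero Y) : IsZero (X ⊞ Y) := by
  rw [IsZero.iff_id_eq_zero]
  apply biprod.hom_ext
  · exact hX.eq_of_tgt _ _
  · exact hY.eq_of_tgt _ _

/-- The decomposition of the entries of a direct sum of complexes. -/
def biprodXIso (I D : CochainComplex A ℤ) (j : ℤ) : (I ⊞ D).X j ≅ I.X j ⊞ D.X j :=
  (HomologicalComplex.eval A (ComplexShape.up ℤ) j).mapBiprod I D

/-- Complexes in nonnegative degrees embed purely into standard relatively injective complexes with
prescribed injective homology. -/
lemma exists_isPureMono [EnoughInjectives A] (P : CochainComplex A ℤ)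
    (hP : ∀ j < 0, IsZero (P.X j)) {N : CochainComplex A ℤ} (hN : ∀ i j, N.d i j = 0)
    [∀ j, Injective (N.X j)] (ν : ∀ j, P.homology j ⟶ N.X j) [∀ j, Mono (ν j)] :
    ∃ (E : CochainComplex A ℤ) (ι : P ⟶ E), IsRelativelyInjective E ∧ IsPureMono ι ∧
      (∀ j, Injective (E.X j)) ∧ (∀ j, Injective (E.homology j)) ∧
      ((∀ j < 0, IsZero (N.X j)) → ∀ j < 0, IsZero (E.X j)) ∧
      ((∀ j, IsIso (ν j)) → QuasiIso ι) := by
  -- `T` must vanish at 0 too, since `splitAcyclicOf T` has `T (j + 1)` in degree `j`. Thus `a 0` is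
  -- zero and monicity in degree 0 needs a separate argument.
  have : ∀ j, ∃ (T : A) (a : P.X j ⟶ T), Injective T ∧ (0 < j → Mono a) ∧
      (j ≤ 0 → IsZero T) := by
    intro j
    by_cases hj : 0 < j
    · exact ⟨_, Injective.ι _, inferInstance, fun _ => inferInstance, fun h => by lia⟩
    · exact ⟨_, 0, (isZero_zero A).injective, fun h => by lia, fun _ => isZero_zero _⟩
  choose T a hT ha hT0 using this
  let r : ∀ j, P.opcycles j ⟶ N.X j := fun j => Injective.factorThru (ν j) (P.homologyι j)
  have hr : ∀ j, P.homologyι j ≫ r j = ν j := fun j => Injective.comp_factorThru _ _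
  let ι : P ⟶ N ⊞ splitAcyclicOf T := biprod.lift (toZeroDiff P hN r) (toSplitAcyclicOf P a)
  have q := quasiIso_biprod_fst N (splitAcyclicOf T) (splitAcyclicOf_acyclic T)
  have hpO : ∀ j, IsIso (N.pOpcycles j) := fun j => isIso_pOpcycles _ (j - 1) j (by simp) (hN _ _)
  have hι : ∀ j, IsIso (N.homologyι j) := fun j => isIso_homologyι _ j (j + 1) (by simp) (hN _ _)
  have hinj : ∀ j, Injective ((splitAcyclicOf T).X j) := fun j =>
    inferInstanceAs (Injective (T j ⊞ T (j + 1)))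
  have hmap : ∀ j, homologyMap (toZeroDiff P hN r) j =
      ν j ≫ N.pOpcycles j ≫ inv (N.homologyι j) := fun j => by
    rw [← cancel_mono (N.homologyι j), homologyMap_toZeroDiff, reassoc_of% (hr j)]
    simp
  have hfst : ι ≫ biprod.fst = toZeroDiff P hN r := by simp [ι]
  have hsnd : ι ≫ biprod.snd = toSplitAcyclicOf P a := by simp [ι]
  refine ⟨_, ι, (isRelativelyInjective_of_d_eq_zero N hN).biprod
    (isRelativelyInjective_splitAcyclicOf T), (isPureMono_iff _).2 ⟨?_, fun j => ?_⟩,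
    fun j => ?_, fun j => ?_, fun hN j hj => ?_, fun h => ?_⟩
  · have : ∀ j, Mono (ι.f j) := by
      intro j
      apply Preadditive.mono_of_cancel_zero
      intro W x hx
      have h1 : x ≫ P.pOpcycles j ≫ r j = 0 := by
        have := hx =≫ (biprod.fst : _ ⟶ N).f j
        rw [Category.assoc, ← comp_f, hfst] at this
        simpa using this
      have h2 : x ≫ lift (a j) (P.d j (j + 1) ≫ a (j + 1)) = 0 := by
        have := hx =≫ (biprod.snd : _ ⟶ splitAcyclicOf T).f j
        rw [Category.assoc, ← comp_f, hsnd] at this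
        simpa using this
      have h3 : x ≫ a j = 0 := by simpa using h2 =≫ fst T j
      have h4 : (x ≫ P.d j (j + 1)) ≫ a (j + 1) = 0 := by simpa using h2 =≫ snd T j
      obtain hj | rfl | hj := lt_trichotomy j 0
      · exact (hP j hj).eq_of_tgt _ _
      -- As `a 1` is monic, `x` lands in the cycles; in degree 0 these coincide with homology, which
      -- `ν 0` embeds.
      · have := ha (0 + 1) (by lia)
        have h5 := zero_of_comp_mono _ h4
        have h6 : P.liftCycles x (0 + 1) (by simp) h5 ≫ P.homologyπ 0 = 0 := by
          rw [← cancel_mono (ν 0), ← hr 0]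
          simpa using h1
        have := P.isIso_homologyπ (-1) 0 (by simp) ((hP (-1) (by lia)).eq_of_src _ _)
        have h7 := zero_of_comp_mono _ h6
        rw [← P.liftCycles_i x (0 + 1) (by simp) h5, h7, zero_comp]
      · have := ha j hj
        exact zero_of_comp_mono _ h3
    exact HomologicalComplex.mono_of_mono_f _ this
  · have : Mono (homologyMap ι j ≫ homologyMap (biprod.fst : _ ⟶ N) j) := by
      rw [← homologyMap_comp, hfst, hmap]
      infer_instance
    exact mono_of_mono _ (homologyMap (biprod.fst : _ ⟶ N) j)
  · exact Injective.of_iso (biprodXIso _ _ j).symm inferInstance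
  · exact Injective.of_iso (N.pOpcyclesIso (j - 1) j (by simp) (hN _ _) ≪≫
      (asIso (N.homologyι j)).symm ≪≫
      (asIso (homologyMap (biprod.fst : _ ⊞ splitAcyclicOf T ⟶ N) j)).symm) inferInstance
  · exact (isZero_biprod (hN j hj) (isZero_biprod (hT0 j (by lia)) (hT0 (j + 1) (by lia)))).of_iso
      (biprodXIso _ _ j)
  · have : QuasiIso (ι ≫ biprod.fst) := by
      rw [hfst, quasiIso_iff]
      intro j
      rw [quasiIsoAt_iff_isIso_homologyMap, hmap]
      infer_instance
    exact quasiIso_of_comp_right _ (biprod.fst : _ ⟶ N)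

/-! ### Relatively injective complexes as retracts of standard ones. -/

/-- The complex with entries `N j` and zero differentials. -/
abbrev zeroDiff (N : ℤ → A) : CochainComplex A ℤ where
  X := N
  d _ _ := 0

lemma IsRelativelyInjective.retract {I E : CochainComplex A ℤ} (hI : IsRelativelyInjective I)
    {ι : I ⟶ E} (hι : IsPureMono ι) : Nonempty (Retract I E) := by
  obtain ⟨r, hr⟩ := hI ι hι (𝟙 I)
  exact ⟨⟨ι, r, hr⟩⟩

lemma IsRelativelyInjective.exists_retract [EnoughInjectives A] {I : CochainComplex A ℤ}
    (hI : IsRelativelyInjective I) (hI0 : ∀ j < 0, IsZero (I.X j)) :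
    ∃ E : CochainComplex A ℤ, Nonempty (Retract I E) ∧ (∀ j, Injective (E.X j)) ∧
      (∀ j, Injective (E.homology j)) := by
  obtain ⟨E, ι, _, h, h1, h2, _⟩ := exists_isPureMono I hI0
    (N := zeroDiff fun j => Injective.under (I.homology j)) (fun _ _ => rfl)
    (fun j => Injective.ι (I.homology j))
  exact ⟨E, hI.retract h, h1, h2⟩

lemma IsRelativelyInjective.injective_X [EnoughInjectives A] {I : CochainComplex A ℤ}
    (hI : IsRelativelyInjective I) (hI0 : ∀ j < 0, IsZero (I.X j)) (j : ℤ) :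
    Injective (I.X j) := by
  obtain ⟨E, ⟨r⟩, h, _⟩ := hI.exists_retract hI0
  have := h j
  exact (show Retract (I.X j) (E.X j) from
    r.map (HomologicalComplex.eval A (ComplexShape.up ℤ) j)).injective

lemma IsRelativelyInjective.injective_homology [EnoughInjectives A] {I : CochainComplex A ℤ}
    (hI : IsRelativelyInjective I) (hI0 : ∀ j < 0, IsZero (I.X j)) (j : ℤ) :
    Injective (I.homology j) := by
  obtain ⟨E, ⟨r⟩, _, h⟩ := hI.exists_retract hI0
  have := h j
  exact (show Retract (I.homology j) (E.homology j) from
    r.map (HomologicalComplex.homologyFunctor A (ComplexShape.up ℤ) j)).injective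

/-- Both complexes are bounded below with injective entries, hence K-injective. -/
lemma isHomotopism_of_quasiIso [EnoughInjectives A] {I I' : CochainComplex A ℤ} (f : I ⟶ I')
    [QuasiIso f] (hI : IsRelativelyInjective I) (hI0 : ∀ j < 0, IsZero (I.X j))
    (hI' : IsRelativelyInjective I') (hI0' : ∀ j < 0, IsZero (I'.X j)) : IsHomotopism f := by
  have := hI.injective_X hI0
  have := hI'.injective_X hI0'
  have : I.IsStrictlyGE 0 := (CochainComplex.isStrictlyGE_iff _ _).2 hI0
  have : I'.IsStrictlyGE 0 := (CochainComplex.isStrictlyGE_iff _ _).2 hI0'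
  have := CochainComplex.isKInjective_of_injective I 0
  have := CochainComplex.isKInjective_of_injective I' 0
  exact (HomologicalComplex.isIso_quotient_map_iff_homotopyEquivalences _).2
    ((CochainComplex.IsKInjective.quasiIso_iff f).1 inferInstance)

/-! ### Homotopy equivalences of double complexes are double homotopisms -/

section Homotopy

lemma isZero_splitAcyclicOf {C : Type*} [Category* C] [Preadditive C] [HasBinaryBiproducts C]
    {T : ℤ → C} (hT : ∀ i, IsZero (T i)) : IsZero (splitAcyclicOf T) := by
  rw [IsZero.iff_id_eq_zero]
  ext j
  exact splitAcyclicOf.hom_ext ((hT _).eq_of_tgt _ _) ((hT _).eq_of_tgt _ _)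

lemma splitAcyclic_of_isVerticallySplitAcyclic {V : DoubleComplex A}
    (hV : IsVerticallySplitAcyclic V) : splitAcyclic A V := by
  let T : ℤ → CochainComplex A ℤ := fun _ => HomologicalComplex.zero
  have h0 : IsZero (splitAcyclicOf T) := isZero_splitAcyclicOf fun _ => HomologicalComplex.isZero_zero
  have hT : IsZero (HomologicalComplex₂.flip (splitAcyclicOf T)) := by
    rw [IsZero.iff_id_eq_zero]
    ext j i
    exact (((HomologicalComplex.eval A _ j).map_isZero
      ((HomologicalComplex.eval (CochainComplex A ℤ) _ i).map_isZero h0))).eq_of_tgt _ _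
  exact ⟨_, V, ⟨T, ⟨Iso.refl _⟩⟩, hV, ⟨isoZeroBiprod hT⟩⟩

/-- The factorization of a null-homotopic morphism through a split acyclic complex. -/
@[simps]
def fromSplitAcyclicOf {C : Type*} [Category* C] [Preadditive C] [HasBinaryBiproducts C]
    {K L : CochainComplex C ℤ} (s : ∀ i j, K.X i ⟶ L.X j) :
    splitAcyclicOf K.X ⟶ L where
  f j := splitAcyclicOf.fst K.X j ≫ prevD j s + splitAcyclicOf.snd K.X j ≫ s (j + 1) j
  comm' i j hij := by
    obtain rfl : i + 1 = j := hij
    rw [prevD_eq s (show (ComplexShape.up ℤ).Rel i (i + 1) by simp)]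
    have h₁ := prevD_eq s (show (ComplexShape.up ℤ).Rel (i - 1) i by simp)
    have e₁ := splitAcyclicOf.d_fst K.X i
    have e₂ := splitAcyclicOf.d_snd K.X i
    rw [Preadditive.comp_add, reassoc_of% e₁, reassoc_of% e₂, h₁]
    simp

/-- The homotopy is one of complexes with values in complexes, so it lives in the vertical
direction; the difference factors over the split acyclic double complex with rows `K.X i ⊞ K.X (i +
1)`. -/
lemma factorRel_of_homotopy {K L : DoubleComplex A} {f g : K ⟶ L} (h : Homotopy f g) :
    factorRel (splitAcyclic A) f g := by
  refine ⟨_, splitAcyclic_of_isVerticallySplitAcyclic ⟨K.X, ⟨Iso.refl _⟩⟩,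
    toSplitAcyclicOf K (fun _ => 𝟙 _), fromSplitAcyclicOf h.hom, ?_⟩
  ext1 j
  rw [comp_f, sub_f_apply, h.comm j, dNext_eq h.hom (show (ComplexShape.up ℤ).Rel j (j + 1) by simp),
    toSplitAcyclicOf_f, fromSplitAcyclicOf_f]
  rw [Preadditive.comp_add]
  have e₁ := splitAcyclicOf.lift_fst (T := K.X) (𝟙 (K.X j)) (K.d j (j + 1))
  have e₂ := splitAcyclicOf.lift_snd (T := K.X) (𝟙 (K.X j)) (K.d j (j + 1))
  rw [Category.comp_id, reassoc_of% e₁, reassoc_of% e₂]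
  abel

lemma isDoubleHomotopism_of_isIso {K L : DoubleComplex A} (f : K ⟶ L)
    (hf : IsIso ((HomotopyCategory.quotient _ (ComplexShape.up ℤ)).map f)) :
    IsDoubleHomotopism f := by
  obtain ⟨e, rfl⟩ := (HomologicalComplex.isIso_quotient_map_iff_homotopyEquivalences f).1 hf
  refine ⟨(residueClassFunctor (splitAcyclic A)).map e.inv, ?_, ?_⟩
  · rw [← Functor.map_comp, ← CategoryTheory.Functor.map_id]
    exact CategoryTheory.Quotient.sound _ (factorRel_of_homotopy e.homotopyHomInvId)
  · rw [← Functor.map_comp, ← CategoryTheory.Functor.map_id]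
    exact CategoryTheory.Quotient.sound _ (factorRel_of_homotopy e.homotopyInvHomId)

/-- A bounded below complex `C` is contractible if each morphism `C.X j ⟶ C.X j` vanishing on
the incoming differential factors through the outgoing one. -/
lemma nonempty_homotopy_id_zero {B : Type*} [Category* B] [Preadditive B]
    (C : CochainComplex B ℤ) (n : ℤ) (hn : ∀ i ≤ n, IsZero (C.X i))
    (hC : ∀ j (a : C.X j ⟶ C.X j), C.d (j - 1) j ≫ a = 0 → ∃ b, C.d j (j + 1) ≫ b = a) :
    Nonempty (Homotopy (𝟙 C) 0) := by
  -- If d s d = d, then 1 - s d kills the incoming differential, hence equals d t; this `t`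
  -- satisfies d t d = d one degree higher, which drives the induction.
  have step : ∀ j (s : C.X j ⟶ C.X (j - 1)), C.d (j - 1) j ≫ s ≫ C.d (j - 1) j = C.d (j - 1) j →
      ∃ t : C.X (j + 1) ⟶ C.X j, C.d j (j + 1) ≫ t = 𝟙 _ - s ≫ C.d (j - 1) j :=
    fun j s hs => hC j _ (by simp [hs])
  have hS : ∀ j, ∃ s : C.X j ⟶ C.X (j - 1), C.d (j - 1) j ≫ s ≫ C.d (j - 1) j = C.d (j - 1) j := by
    intro j
    by_cases hj : j ≤ n
    · exact ⟨0, (hn j hj).eq_of_tgt _ _⟩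
    · induction j, (show n ≤ j by lia) using Int.leInduction with
      | base => exact (hj le_rfl).elim
      | succ j hj ih =>
        have ih' : ∃ s : C.X j ⟶ C.X (j - 1),
            C.d (j - 1) j ≫ s ≫ C.d (j - 1) j = C.d (j - 1) j := by
          by_cases hj' : j ≤ n
          · exact ⟨0, (hn j hj').eq_of_tgt _ _⟩
          · exact ih hj'
        obtain ⟨s, hs⟩ := ih'
        obtain ⟨t, ht⟩ := step j s hs
        have ht' : C.d j (j + 1) ≫ t ≫ C.d j (j + 1) = C.d j (j + 1) := by
          rw [← Category.assoc, ht]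
          simp
        -- `j + 1 - 1` and `j` are only propositionally equal, so the index is generalized before
        -- substitution.
        have : ∀ k, k = j → ∃ s : C.X (j + 1) ⟶ C.X k,
            C.d k (j + 1) ≫ s ≫ C.d k (j + 1) = C.d k (j + 1) := by
          rintro _ rfl
          exact ⟨t, ht'⟩
        exact this _ (by simp)
  choose s hs using hS
  choose t ht using fun j => step j (s j) (hs j)
  have key : ∀ j k, (ComplexShape.up ℤ).Rel j k → ∃ h : C.X k ⟶ C.X j,
      C.d j k ≫ h = 𝟙 _ - s j ≫ C.d (j - 1) j ∧ h ≫ C.d j k = s k ≫ C.d (k - 1) k := by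
    intro j k hjk
    obtain rfl : j + 1 = k := hjk
    have : ∀ i, i = j → ∀ σ : C.X (j + 1) ⟶ C.X i,
        C.d i (j + 1) ≫ σ ≫ C.d i (j + 1) = C.d i (j + 1) →
        ∃ h : C.X (j + 1) ⟶ C.X j, C.d j (j + 1) ≫ h = 𝟙 _ - s j ≫ C.d (j - 1) j ∧
          h ≫ C.d j (j + 1) = σ ≫ C.d i (j + 1) := by
      rintro _ rfl σ hσ
      -- The factor 1 - s d equals d t, so d σ (1 - s d) = d σ d t = d t = 1 - s d; after a further
      -- d its second term dies. The two identities add up to d h + h d = 1.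
      refine ⟨σ ≫ (𝟙 _ - s _ ≫ C.d _ _), ?_, by simp⟩
      rw [← ht]
      simp only [← Category.assoc] at hσ ⊢
      rw [hσ]
    exact this _ (by simp) _ (hs _)
  choose h h₁ h₂ using key
  refine ⟨Homotopy.trans (Homotopy.ofEq ?_) (Homotopy.nullHomotopy'
    (fun i j (hij : (ComplexShape.up ℤ).Rel j i) => h j i hij))⟩
  ext j
  refine Eq.trans ?_ (Homotopy.nullHomotopicMap'_f (k₂ := j - 1) (k₁ := j) (k₀ := j + 1)
    (by simp) (by simp) _).symm
  rw [h₁, h₂]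
  simp

lemma isIso_quotient_map_of_homotopy {B : Type*} [Category* B] [Abelian B]
    {K L : CochainComplex B ℤ} (f : K ⟶ L)
    (h : Nonempty (Homotopy (𝟙 (CochainComplex.mappingCone f)) 0)) :
    IsIso ((HomotopyCategory.quotient B (ComplexShape.up ℤ)).map f) := by
  refine (Pretriangulated.Triangle.isZero₃_iff_isIso₁ _
    (HomotopyCategory.mappingCone_triangleh_distinguished f)).1 ?_
  rw [IsZero.iff_id_eq_zero]
  exact (HomotopyCategory.eq_of_homotopy _ _ h.some)

end Homotopy

/-! ### Cartan-Eilenberg resolutions as relatively injective resolutions -/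

section Resolution

variable {X : CochainComplex A ℤ} {R : DoubleComplex A}

lemma IsCEResolution.isZero_X (hR : IsCEResolution X R) (i : ℤ) (hi : i < 0) : IsZero (R.X i) :=
  hR.1 i hi

lemma IsCEResolution.isRelativelyInjective (hR : IsCEResolution X R) (i : ℤ) :
    IsRelativelyInjective (R.X i) :=
  hR.2.1 i

/-- Since `a` kills the kernel of `d`, it descends to the image of `d`, and then extends because
that image is purely embedded. -/
lemma exists_comp_eq_of_isPure {Y Z I : CochainComplex A ℤ} (hI : IsRelativelyInjective I)
    {d : Y ⟶ Z} (hd : IsPure d) (a : Y ⟶ I)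
    (ha : ∀ ⦃W : CochainComplex A ℤ⦄ (x : W ⟶ Y), x ≫ d = 0 → x ≫ a = 0) :
    ∃ b, d ≫ b = a := by
  obtain ⟨Q, p, m, ⟨W, x, w, hS, _⟩, hm, rfl⟩ := hd
  have := hS.epi_g
  obtain ⟨b, hb⟩ := hI m hm (hS.exact.desc a (ha x (by simp [reassoc_of% w])))
  exact ⟨b, by rw [Category.assoc, hb]; exact hS.exact.g_desc _ _⟩

lemma IsCEResolution.exists_comp_eq (hR : IsCEResolution X R) {I : CochainComplex A ℤ}
    (hI : IsRelativelyInjective I) (i : ℤ) (a : R.X i ⟶ I) (ha : R.iCycles i ≫ a = 0) :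
    ∃ b : R.X (i + 1) ⟶ I, R.d i (i + 1) ≫ b = a :=
  exists_comp_eq_of_isPure hI (hR.2.2.1 i) a fun W x hx => by
    rw [← R.liftCycles_i x (i + 1) (by simp) hx, Category.assoc, ha, comp_zero]

/-- The kernel of a pure morphism is the kernel of its pure epimorphic part. -/
lemma isPureMono_iCycles {i : ℤ} (hd : IsPure (R.d i (i + 1))) : IsPureMono (R.iCycles i) := by
  obtain ⟨Q, p, m, ⟨W, x, w, hx⟩, hm, h⟩ := hd
  obtain ⟨hS, _⟩ := id hx
  have := hm.mono
  have := hS.mono_f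
  have h1 : R.iCycles i ≫ p = 0 := by simp [← cancel_mono m, h]
  have h2 : x ≫ R.d i (i + 1) = 0 := by rw [← h, reassoc_of% w, zero_comp]
  let l : R.cycles i ⟶ W := hS.exact.lift (R.iCycles i) h1
  have hl : l ≫ x = R.iCycles i := hS.exact.lift_f _ _
  have : IsIso l := ⟨R.liftCycles x (i + 1) (by simp) h2, by simp [← cancel_mono (R.iCycles i), hl],
    by simp [← cancel_mono x, hl]⟩
  rw [← hl]
  exact (isPureMono_of_quasiIso l).comp ⟨_, _, _, hx⟩

lemma IsCEResolution.isPureMono_iCycles (hR : IsCEResolution X R) (i : ℤ) :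
    IsPureMono (R.iCycles i) :=
  CartanEilenberg.isPureMono_iCycles (hR.2.2.1 i)

lemma IsCEResolution.exactAt (hR : IsCEResolution X R) (i : ℤ) (hi : i ≠ 0) : R.ExactAt i := by
  obtain ⟨-, -, -, ε, hε, -⟩ := hR
  exact (exactAt_iff_of_quasiIsoAt ε i).1 (exactAt_single_obj _ _ _ _ hi)

lemma epi_toCycles {C : Type*} [Category* C] [Abelian C] {R : CochainComplex C ℤ}
    {i j : ℤ} (hij : i + 1 = j) (hj : R.ExactAt j) : Epi (R.toCycles i j) := by
  apply Preadditive.epi_of_cancel_zero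
  intro Z x hx
  have hz := (exactAt_iff_isZero_homology _ _).1 hj
  obtain ⟨l, hl⟩ := CokernelCofork.IsColimit.desc' (R.homologyIsCokernel i j (by simp [← hij])) x hx
  rw [← hl, hz.eq_of_src l 0, comp_zero]

lemma iCycles_comp_eq_zero {C : Type*} [Category* C] [Abelian C] {R : CochainComplex C ℤ}
    {i j : ℤ} (hij : i + 1 = j) (hj : R.ExactAt j) {I : C} (a : R.X j ⟶ I)
    (ha : R.d i j ≫ a = 0) : R.iCycles j ≫ a = 0 := by
  have := epi_toCycles hij hj
  rw [← cancel_epi (R.toCycles i j), toCycles_i_assoc, ha, comp_zero]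

lemma shortExact_cycles {C : Type*} [Category* C] [Abelian C] {R : CochainComplex C ℤ}
    {i j : ℤ} (hij : i + 1 = j) (hj : R.ExactAt j) :
    (ShortComplex.mk (R.iCycles i) (R.toCycles i j)
      (by simp [← cancel_mono (R.iCycles j)])).ShortExact where
  exact := ShortComplex.exact_of_f_is_kernel _ (KernelFork.IsLimit.ofι' _ _ fun k hk =>
    ⟨R.liftCycles k j (by simp [← hij]) (by rw [← R.toCycles_i, reassoc_of% hk, zero_comp]),
      by simp⟩)
  mono_f := inferInstanceAs (Mono (R.iCycles i))
  epi_g := epi_toCycles hij hj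

end Resolution

/-! ### Comparison of resolutions through the mapping cone. -/

section Comparison

open CochainComplex

variable {X X' : CochainComplex A ℤ} {K L : DoubleComplex A}

lemma isRelativelyInjective_mappingCone (h : K ⟶ L) (hK : IsCEResolution X K)
    (hL : IsCEResolution X' L) (j : ℤ) : IsRelativelyInjective ((mappingCone h).X j) := by
  intro Y Z m hm g
  obtain ⟨a, ha⟩ := hK.isRelativelyInjective (j + 1) m hm
    (g ≫ (mappingCone.fst h).1.v j (j + 1) rfl)
  obtain ⟨b, hb⟩ := hL.isRelativelyInjective j m hm (g ≫ (mappingCone.snd h).v j j (add_zero j))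
  refine ⟨a ≫ (mappingCone.inl h).v (j + 1) j (by lia) + b ≫ (mappingCone.inr h).f j, ?_⟩
  apply mappingCone.ext_to h j (j + 1) rfl <;> simp [ha, hb]

/-- `γ` extends the restriction of `α` to Z^0(K) ≅ Z^0(L) along the pure monomorphism Z^0(L) → L^0;
then h γ - α vanishes on Z^0(K). The index `k` is kept variable for use at `-1 + 1`. -/
lemma exists_comp_eq_sub (h : K ⟶ L) (hK : IsCEResolution X K) (hL : IsCEResolution X' L)
    [IsIso (cyclesMap h 0)] {I : CochainComplex A ℤ} (hI : IsRelativelyInjective I)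
    {k : ℤ} (hk : k = 0) (α : K.X k ⟶ I) :
    ∃ (γ : L.X k ⟶ I) (e : K.X (k + 1) ⟶ I), K.d k (k + 1) ≫ e = h.f k ≫ γ - α := by
  subst hk
  obtain ⟨γ, hγ⟩ := hI (L.iCycles 0) (hL.isPureMono_iCycles 0)
    (inv (cyclesMap h 0) ≫ K.iCycles 0 ≫ α)
  exact ⟨γ, hK.exists_comp_eq hI 0 (h.f 0 ≫ γ - α) (by
    rw [Preadditive.comp_sub, ← cyclesMap_i_assoc, hγ]
    simp)⟩

/-- Homming the cone into a relatively injective complex gives an exact complex. In components, `a`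
is a pair (α, β), and a preimage is a pair (e, γ) solving two equations. -/
lemma exists_comp_eq_mappingCone (h : K ⟶ L) (hK : IsCEResolution X K)
    (hL : IsCEResolution X' L) [IsIso (cyclesMap h 0)] {I : CochainComplex A ℤ}
    (hI : IsRelativelyInjective I) (j : ℤ) (a : (mappingCone h).X j ⟶ I)
    (ha : (mappingCone h).d (j - 1) j ≫ a = 0) : ∃ b, (mappingCone h).d j (j + 1) ≫ b = a := by
  let α : K.X (j + 1) ⟶ I := (mappingCone.inl h).v (j + 1) j (by lia) ≫ a
  let β : L.X j ⟶ I := (mappingCone.inr h).f j ≫ a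
  have hβ : L.d (j - 1) j ≫ β = 0 := by
    simp only [β]
    rw [← mappingCone.inr_f_d_assoc, ha, comp_zero]
  have hα : h.f j ≫ β = K.d j (j + 1) ≫ α := by
    have := (mappingCone.inl h).v j (j - 1) (by lia) ≫= ha
    rw [mappingCone.inl_v_d_assoc h j (j - 1) (j + 1) (by lia) (by lia), comp_zero,
      Preadditive.sub_comp, sub_eq_zero] at this
    simpa using this
  suffices ∃ (γ : L.X (j + 1) ⟶ I) (e : K.X (j + 1 + 1) ⟶ I), L.d j (j + 1) ≫ γ = β ∧
      K.d (j + 1) (j + 1 + 1) ≫ e = h.f (j + 1) ≫ γ - α by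
    obtain ⟨γ, e, h₁, h₂⟩ := this
    refine ⟨(mappingCone.fst h).1.v (j + 1) (j + 1 + 1) rfl ≫ e +
      (mappingCone.snd h).v (j + 1) (j + 1) (add_zero _) ≫ γ, ?_⟩
    apply mappingCone.ext_from h (j + 1) j rfl
    · rw [mappingCone.inl_v_d_assoc h (j + 1) j (j + 1 + 1) (by lia) (by lia)]
      simp [h₂, α]
    · rw [mappingCone.inr_f_d_assoc]
      simp [h₁, β]
  -- For `0 ≤ j` solve for `γ`, then for `e`; at `j = 0` the isomorphism on zeroth cycles replaces
  -- exactness of `L`. For `j = -1` the condition on `γ` is void, but `γ` must be chosen so that `e`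
  -- exists.
  obtain hj | hj := le_or_gt 0 j
  · have h₁ : L.iCycles j ≫ β = 0 := by
      obtain rfl | hj := hj.eq_or_lt
      · rw [← cancel_epi (cyclesMap h 0), cyclesMap_i_assoc, hα]
        simp
      · exact iCycles_comp_eq_zero (by lia) (hL.exactAt j hj.ne') _ hβ
    obtain ⟨γ, hγ⟩ := hL.exists_comp_eq hI j β h₁
    obtain ⟨e, he⟩ := hK.exists_comp_eq hI (j + 1) (h.f (j + 1) ≫ γ - α)
      (iCycles_comp_eq_zero (i := j) rfl (hK.exactAt _ (by lia)) _ (by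
        rw [Preadditive.comp_sub, ← hα, ← h.comm_assoc, hγ, sub_self]))
    exact ⟨γ, e, hγ, he⟩
  · obtain rfl | hj : j = -1 ∨ j < -1 := by lia
    · obtain ⟨γ, e, he⟩ := exists_comp_eq_sub h hK hL hI (k := -1 + 1) (by simp) α
      exact ⟨γ, e, (hL.isZero_X _ (by lia)).eq_of_src _ _, he⟩
    · exact ⟨0, 0, (hL.isZero_X _ (by lia)).eq_of_src _ _,
        (hK.isZero_X _ (by lia)).eq_of_src _ _⟩

lemma isDoubleHomotopism_of_isIso_cyclesMap (h : K ⟶ L) (hK : IsCEResolution X K)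
    (hL : IsCEResolution X' L) [IsIso (cyclesMap h 0)] : IsDoubleHomotopism h := by
  refine isDoubleHomotopism_of_isIso h (isIso_quotient_map_of_homotopy h
    -- The cone has entry K^{i+1} ⊕ L^i at position i, so it vanishes only from -2 downwards.
    (nonempty_homotopy_id_zero _ (-2) (fun i hi => ?_) fun j a ha =>
      exists_comp_eq_mappingCone h hK hL (isRelativelyInjective_mappingCone h hK hL j) j a ha))
  rw [mappingCone.isZero_X_iff]
  exact ⟨hK.isZero_X _ (by lia), hL.isZero_X _ (by lia)⟩

end Comparison

/-! ### The rowwise construction of the intermediate resolution -/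

section Pushout

variable {Z M Y : CochainComplex A ℤ} (φ : Z ⟶ M) (m : Z ⟶ Y)

/-- Both parallel monomorphisms `m` and `pushout.inl φ m` have the same cokernel, so the five lemma
applies. -/
lemma quasiIso_pushout_inr [Mono m] [QuasiIso φ] : QuasiIso (pushout.inr φ m) := by
  let p : pushout φ m ⟶ cokernel m := pushout.desc 0 (cokernel.π m) (by simp)
  have w : pushout.inl φ m ≫ p = 0 := pushout.inl_desc _ _ _
  have hp : pushout.inr φ m ≫ p = cokernel.π m := pushout.inr_desc _ _ _
  have hp' : Epi p := by
    have : Epi (pushout.inr φ m ≫ p) := by rw [hp]; infer_instance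
    exact epi_of_epi (pushout.inr φ m) p
  have hS : (ShortComplex.mk _ _ w).ShortExact :=
    { exact := ShortComplex.exact_of_g_is_cokernel _ (CokernelCofork.IsColimit.ofπ' _ _
        fun {W} x hx => by
          have hx' : m ≫ pushout.inr φ m ≫ x = 0 := by
            rw [← pushout.condition_assoc]
            exact (congrArg (φ ≫ ·) hx).trans comp_zero
          refine ⟨cokernel.desc m (pushout.inr φ m ≫ x) hx', pushout.hom_ext ?_ ?_⟩
          · rw [reassoc_of% w, zero_comp]
            exact hx.symm
          · rw [reassoc_of% hp, cokernel.π_desc])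
      mono_f := inferInstanceAs (Mono (pushout.inl φ m))
      epi_g := hp' }
  let f : ShortComplex.mk m (cokernel.π m) (cokernel.condition m) ⟶ ShortComplex.mk _ _ w :=
    ShortComplex.homMk φ (pushout.inr φ m) (𝟙 (cokernel m)) pushout.condition
      (hp.trans (Category.comp_id _).symm)
  exact quasiIso_middle f (shortExact_cokernel m) hS ‹QuasiIso φ›
    (inferInstanceAs (QuasiIso (𝟙 (cokernel m))))

lemma isPureMono_pushout_inl (hm : IsPureMono m) [QuasiIso φ] :
    IsPureMono (pushout.inl φ m) := by
  have := hm.mono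
  have := quasiIso_pushout_inr φ m
  refine (isPureMono_iff _).2 ⟨inferInstance, fun i => ?_⟩
  have := hm.mono_homologyMap i
  have h : homologyMap (pushout.inl φ m) i =
      inv (homologyMap φ i) ≫ homologyMap m i ≫ homologyMap (pushout.inr φ m) i := by
    rw [IsIso.eq_inv_comp, ← homologyMap_comp, ← homologyMap_comp, pushout.condition]
  rw [h]
  infer_instance

lemma isZero_of_epi_f {K L : CochainComplex A ℤ} (f : K ⟶ L) [Epi f] (j : ℤ)
    (hK : IsZero (K.X j)) : IsZero (L.X j) := by
  rw [IsZero.iff_id_eq_zero, ← cancel_epi (f.f j)]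
  exact hK.eq_of_src _ _

lemma isZero_pushout_X (j : ℤ) (hM : IsZero (M.X j)) (hY : IsZero (Y.X j)) :
    IsZero ((pushout φ m).X j) := by
  have : Epi (biprod.desc (pushout.inl φ m) (pushout.inr φ m)) := by
    apply Preadditive.epi_of_cancel_zero
    intro W x hx
    apply pushout.hom_ext
    · simpa using biprod.inl ≫= hx
    · simpa using biprod.inr ≫= hx
  exact isZero_of_epi_f (biprod.desc (pushout.inl φ m) (pushout.inr φ m)) j
    ((isZero_biprod hM hY).of_iso (biprodXIso M Y j))

/-- Given a pure monomorphism `m` and a quasi-isomorphism `φ` out of the same complex, there is a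
commutative square completing them, with a relatively injective fourth corner, a parallel pure
monomorphism and a parallel quasi-isomorphism, which is weakly universal among squares ending in
relatively injective complexes. -/
lemma exists_square [EnoughInjectives A] (hm : IsPureMono m) [QuasiIso φ]
    (hM : ∀ j < 0, IsZero (M.X j)) (hY : IsRelativelyInjective Y) (hY0 : ∀ j < 0, IsZero (Y.X j)) :
    ∃ (E : CochainComplex A ℤ) (ι : M ⟶ E) (g : Y ⟶ E), IsRelativelyInjective E ∧
      (∀ j < 0, IsZero (E.X j)) ∧ IsPureMono ι ∧ QuasiIso g ∧ φ ≫ ι = m ≫ g ∧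
      ∀ {I : CochainComplex A ℤ} (_ : IsRelativelyInjective I) (a : M ⟶ I) (b : Y ⟶ I),
        φ ≫ a = m ≫ b → ∃ h : E ⟶ I, ι ≫ h = a ∧ g ≫ h = b := by
  have := hm.mono
  have := quasiIso_pushout_inr φ m
  have hP : ∀ j < 0, IsZero ((pushout φ m).X j) := fun j hj =>
    isZero_pushout_X φ m j (hM j hj) (hY0 j hj)
  -- The pushout has the homology of `Y`, which is injective; hence `ν` may be the identity, making
  -- the embedding `κ` a quasi-isomorphism.
  have : ∀ j, Injective ((zeroDiff fun j => (pushout φ m).homology j).X j) := fun j =>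
    Injective.of_iso (asIso (homologyMap (pushout.inr φ m) j)) (hY.injective_homology hY0 j)
  obtain ⟨E, κ, hE, hκ, -, -, hE0, hq⟩ := exists_isPureMono (pushout φ m) hP
    (N := zeroDiff fun j => (pushout φ m).homology j) (fun _ _ => rfl) (fun j => 𝟙 _)
  have := hq fun _ => inferInstance
  refine ⟨E, pushout.inl φ m ≫ κ, pushout.inr φ m ≫ κ, hE, hE0 fun j hj => ?_,
    (isPureMono_pushout_inl φ m hm).comp hκ, inferInstance, pushout.condition_assoc _,
    fun hI a b hab => ?_⟩
  · exact (exactAt_iff_isZero_homology _ _).1 (ExactAt.of_isZero (hP j hj))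
  · obtain ⟨h, hh⟩ := hI κ hκ (pushout.desc a b hab)
    exact ⟨h, by rw [Category.assoc, hh, pushout.inl_desc], by
      rw [Category.assoc, hh, pushout.inr_desc]⟩

end Pushout

/-! ### Inductive construction of cycles and rows. -/

variable {J J' : DoubleComplex A}

/-- A complex in nonnegative degrees which is quasi-isomorphic to the `i`-th cycles of `J`, through
which the map to `J'` factors: these are the `i`-th cycles of the intermediate resolution. -/
structure Stage (fhat : J ⟶ J') (i : ℤ) where
  /-- the underlying complex -/
  M : CochainComplex A ℤ
  isZero_M : ∀ j < 0, IsZero (M.X j)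
  /-- the comparison with the cycles of `J` -/
  φ : J.cycles i ⟶ M
  quasiIso_φ : QuasiIso φ
  /-- the map to `J'` -/
  ψ : M ⟶ J'.X i
  ψ_d : ∀ k, ψ ≫ J'.d i k = 0
  φ_ψ : φ ≫ ψ = J.iCycles i ≫ fhat.f i

/-- A row `E` connecting two consecutive stages. -/
structure Row {fhat : J ⟶ J'} {i i' : ℤ} (S : Stage fhat i) (S' : Stage fhat i')
    (E : CochainComplex A ℤ) where
  /-- the inclusion of the cycles -/
  ι : S.M ⟶ E
  /-- the map to the next cycles -/
  π : E ⟶ S'.M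
  /-- the map from `J` -/
  g : J.X i ⟶ E
  /-- the map to `J'` -/
  h : E ⟶ J'.X i
  ι_π : ι ≫ π = 0
  -- Fails in general at `i = -1`: the row is zero there, whereas the next cycles are those in
  -- position 0.
  shortExact : 0 ≤ i → (ShortComplex.mk ι π ι_π).ShortExact
  isPureMono_ι : IsPureMono ι
  isRelativelyInjective : IsRelativelyInjective E
  isZero_X : ∀ j < 0, IsZero (E.X j)
  isZero : i < 0 → IsZero E
  quasiIso_g : QuasiIso g
  φ_ι : S.φ ≫ ι = J.iCycles i ≫ g
  ι_h : ι ≫ h = S.ψ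
  g_h : g ≫ h = fhat.f i
  g_π : g ≫ π = J.toCycles i i' ≫ S'.φ
  π_ψ : π ≫ S'.ψ = h ≫ J'.d i i'

variable {X X' : CochainComplex A ℤ} {fhat : J ⟶ J'}

/-- The square over `S.φ` and Z^i(J) → J^i supplies the row; the next stage is the cokernel of `ι`,
compared with Z^{i+1}(J) ≅ J^i / Z^i(J). -/
lemma Stage.exists_row [EnoughInjectives A] (hJ : IsCEResolution X J) (hJ0 : IsFirstQuadrant J)
    (hJ' : IsCEResolution X' J') {i i' : ℤ} (hi : 0 ≤ i) (hii' : i + 1 = i')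
    (S : Stage fhat i) : ∃ (S' : Stage fhat i') (E : CochainComplex A ℤ), Nonempty (Row S S' E) := by
  have := S.quasiIso_φ
  obtain ⟨E, ι, g, hE, hE0, hι, hg, hc, hu⟩ := exists_square S.φ (J.iCycles i)
    (hJ.isPureMono_iCycles i) S.isZero_M (hJ.isRelativelyInjective i)
    (fun j hj => hJ0 i j (Or.inr hj))
  obtain ⟨h, hh₁, hh₂⟩ := hu (hJ'.isRelativelyInjective i) S.ψ (fhat.f i) S.φ_ψ
  have := hι.mono
  have hS := shortExact_cycles hii' (hJ.exactAt i' (by lia))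
  have : Epi (J.toCycles i i') := hS.epi_g
  have hw : J.iCycles i ≫ g ≫ cokernel.π ι = 0 := by rw [← reassoc_of% hc]; simp
  let φ' : J.cycles i' ⟶ cokernel ι := hS.exact.desc (g ≫ cokernel.π ι) hw
  have hφ' : J.toCycles i i' ≫ φ' = g ≫ cokernel.π ι := hS.exact.g_desc _ _
  let ψ' : cokernel ι ⟶ J'.X i' := cokernel.desc ι (h ≫ J'.d i i') (by
    rw [reassoc_of% hh₁, S.ψ_d])
  have hψ' : cokernel.π ι ≫ ψ' = h ≫ J'.d i i' := cokernel.π_desc _ _ _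
  let S' : Stage fhat i' :=
    { M := cokernel ι
      isZero_M := fun j hj => isZero_of_epi_f (cokernel.π ι) j (hE0 j hj)
      φ := φ'
      quasiIso_φ := HomologySequence.quasiIso_τ₃
        (S₁ := ShortComplex.mk (J.iCycles i) (J.toCycles i i') (by
          simp [← cancel_mono (J.iCycles i')]))
        (S₂ := ShortComplex.mk ι (cokernel.π ι) (cokernel.condition ι))
        (ShortComplex.homMk S.φ g φ' hc hφ'.symm) hS (shortExact_cokernel ι) ‹_› hg
      ψ := ψ'
      ψ_d := fun k => by
        rw [← cancel_epi (cokernel.π ι), reassoc_of% hψ']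
        simp
      φ_ψ := by
        rw [← cancel_epi (J.toCycles i i'), reassoc_of% hφ', hψ', reassoc_of% hh₂]
        simp }
  exact ⟨S', E, ⟨
    { ι := ι
      π := cokernel.π ι
      g := g
      h := h
      ι_π := cokernel.condition ι
      shortExact := fun _ => shortExact_cokernel ι
      isPureMono_ι := hι
      isRelativelyInjective := hE
      isZero_X := hE0
      isZero := fun h => by lia
      quasiIso_g := hg
      φ_ι := hc
      ι_h := hh₁
      g_h := hh₂
      g_π := hφ'.symm
      π_ψ := hψ' }⟩⟩

lemma isRelativelyInjective_of_isZero {E : CochainComplex A ℤ} (hE : IsZero E) :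
    IsRelativelyInjective E := fun _ _ _ _ _ => ⟨0, hE.eq_of_tgt _ _⟩

lemma quasiIso_of_isZero {K L : CochainComplex A ℤ} (f : K ⟶ L) (hK : IsZero K) (hL : IsZero L) :
    QuasiIso f := by
  have : IsIso f := ⟨0, hK.eq_of_src _ _, hL.eq_of_src _ _⟩
  infer_instance

lemma isZero_cycles {C : Type*} [Category* C] [Abelian C] {R : CochainComplex C ℤ} {i : ℤ}
    (h : IsZero (R.X i)) : IsZero (R.cycles i) := by
  rw [IsZero.iff_id_eq_zero, ← cancel_mono (R.iCycles i)]
  exact h.eq_of_tgt _ _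

/-- The zero stage in negative degrees. -/
def Stage.zero (fhat : J ⟶ J') (i : ℤ) (hJ : IsZero (J.X i)) : Stage fhat i where
  M := HomologicalComplex.zero
  isZero_M j _ := (HomologicalComplex.eval A (ComplexShape.up ℤ) j).map_isZero
    HomologicalComplex.isZero_zero
  φ := 0
  quasiIso_φ := quasiIso_of_isZero _ (isZero_cycles hJ) HomologicalComplex.isZero_zero
  ψ := 0
  ψ_d := by simp
  φ_ψ := (isZero_cycles hJ).eq_of_src _ _

lemma Stage.exists_row_of_isZero {i i' : ℤ} (hi : i < 0) (S : Stage fhat i) (S' : Stage fhat i')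
    (hS : IsZero S.M) (hJ : IsZero (J.X i)) :
    ∃ (E : CochainComplex A ℤ), Nonempty (Row S S' E) := by
  have hE : IsZero (HomologicalComplex.zero : CochainComplex A ℤ) := HomologicalComplex.isZero_zero
  exact ⟨_, ⟨
    { ι := 0
      π := 0
      g := 0
      h := 0
      ι_π := comp_zero
      shortExact := fun h => by lia
      isPureMono_ι := isPureMono_of_isZero _ hS
      isRelativelyInjective := isRelativelyInjective_of_isZero hE
      isZero_X := fun j _ => (HomologicalComplex.eval A _ j).map_isZero hE
      isZero := fun _ => hE
      quasiIso_g := quasiIso_of_isZero _ hJ hE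
      φ_ι := hE.eq_of_tgt _ _
      ι_h := hS.eq_of_src _ _
      g_h := hJ.eq_of_src _ _
      g_π := hJ.eq_of_src _ _
      π_ψ := hE.eq_of_src _ _ }⟩⟩

/-- Extension of a stage in degree `0` to stages in all degrees, connected by rows. -/
lemma exists_stages [EnoughInjectives A] (hJ : IsCEResolution X J) (hJ0 : IsFirstQuadrant J)
    (hJ' : IsCEResolution X' J') (S₀ : Stage fhat 0) :
    ∃ S : ∀ i, Stage fhat i, S 0 = S₀ ∧
      ∀ i i', i + 1 = i' → ∃ E, Nonempty (Row (S i) (S i') E) := by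
  have step : ∀ (n : ℕ) (S : Stage fhat (Int.ofNat n)), ∃ (S' : Stage fhat (Int.ofNat (n + 1)))
      (E : CochainComplex A ℤ), Nonempty (Row S S' E) := fun n S =>
    S.exists_row hJ hJ0 hJ' (Int.natCast_nonneg n) rfl
  choose next hnext using step
  let s : ∀ n : ℕ, Stage fhat (Int.ofNat n) := fun n => Nat.rec S₀ next n
  let S : ∀ i, Stage fhat i := fun i => match i with
    | Int.ofNat n => s n
    | Int.negSucc n => Stage.zero fhat _ (hJ.isZero_X _ (Int.negSucc_lt_zero n))
  refine ⟨S, rfl, fun i i' h => ?_⟩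
  match i, i', h with
  | Int.ofNat n, Int.ofNat m, h =>
    obtain rfl : m = n + 1 := by
      have : (n : ℤ) + 1 = m := h
      lia
    exact hnext n (s n)
  | Int.ofNat n, Int.negSucc m, h =>
    have : (n : ℤ) + 1 = Int.negSucc m := h
    lia
  | Int.negSucc n, i', h =>
    exact Stage.exists_row_of_isZero (Int.negSucc_lt_zero n) _ _
      (show IsZero (Stage.zero fhat _ (hJ.isZero_X _ (Int.negSucc_lt_zero n))).M from
        HomologicalComplex.isZero_zero)
      (hJ.isZero_X _ (Int.negSucc_lt_zero n))

lemma exists_cochainComplex {S : ∀ i, Stage fhat i}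
    (hS : ∀ i i', i + 1 = i' → ∃ E, Nonempty (Row (S i) (S i') E)) :
    ∃ (K : DoubleComplex A) (r : ∀ i, Row (S i) (S (i + 1)) (K.X i)),
      ∀ i, K.d i (i + 1) = (r i).π ≫ (r (i + 1)).ι := by
  choose E hE using fun i => hS i (i + 1) rfl
  let r : ∀ i, Row (S i) (S (i + 1)) (E i) := fun i => (hE i).some
  exact ⟨CochainComplex.of E (fun i => (r i).π ≫ (r (i + 1)).ι)
    (fun i => by rw [Category.assoc, reassoc_of% (r (i + 1)).ι_π, zero_comp, comp_zero]), r,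
    fun i => CochainComplex.of_d E (fun i => (r i).π ≫ (r (i + 1)).ι) i⟩

lemma isPure_of_isZero {Y Z : CochainComplex A ℤ} (f : Y ⟶ Z) (hY : IsZero Y) : IsPure f := by
  have hS : (ShortComplex.mk (0 : Y ⟶ Y) (𝟙 Y) zero_comp).ShortExact :=
    { exact := ShortComplex.exact_of_isZero_X₂ _ hY
      mono_f := ⟨fun _ _ _ => hY.eq_of_tgt _ _⟩
      epi_g := inferInstanceAs (Epi (𝟙 Y)) }
  exact ⟨Y, 𝟙 Y, f, ⟨Y, 0, zero_comp, (isPureMono_of_isZero 0 hY).isPureShortExact _ _ hS⟩,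
    isPureMono_of_isZero f hY, Category.id_comp f⟩

lemma exact_of_eq_iso_hom_comp {C : Type*} [Category* C] [Abelian C] {X X' Y Z : C}
    (e : X' ≅ X) {f : X ⟶ Y} {g : Y ⟶ Z} {f' : X' ⟶ Y} (hf' : f' = e.hom ≫ f) {w : f ≫ g = 0}
    (w' : f' ≫ g = 0) (h : (ShortComplex.mk f g w).Exact) : (ShortComplex.mk f' g w').Exact := by
  let i : ShortComplex.mk f' g w' ≅ ShortComplex.mk f g w :=
    ShortComplex.isoMk e (Iso.refl Y) (Iso.refl Z) (by simp [hf']) (by simp)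
  exact (ShortComplex.exact_iff_of_iso i).2 h

/-! ### The glued rows form a resolution factoring the given morphism. -/

section Assembly

variable {S : ∀ i, Stage fhat i} {K : DoubleComplex A}
  (r : ∀ i, Row (S i) (S (i + 1)) (K.X i)) (hK : ∀ i, K.d i (i + 1) = (r i).π ≫ (r (i + 1)).ι)

include hK

lemma ι_comp_d (i : ℤ) : (r i).ι ≫ K.d i (i + 1) = 0 := by
  rw [hK, reassoc_of% (r i).ι_π, zero_comp]

lemma exact_ι_d (i : ℤ) (hi : 0 ≤ i) :
    (ShortComplex.mk _ _ (ι_comp_d r hK i)).Exact := by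
  have := (r (i + 1)).isPureMono_ι.mono
  have hm : Mono (ShortComplex.mk _ _ (ι_comp_d r hK i)).f := (r i).isPureMono_ι.mono
  refine ShortComplex.exact_of_f_is_kernel _ (KernelFork.IsLimit.ofι' _ _ fun k hk => ?_)
  · have hk' : k ≫ (r i).π = 0 := by
      rw [← cancel_mono (r (i + 1)).ι, Category.assoc, ← hK, zero_comp]
      exact hk
    have hS := (r i).shortExact hi
    have := hS.mono_f
    exact ⟨hS.exact.lift k hk', hS.exact.lift_f _ _⟩

lemma exactAt_of_row (i : ℤ) (hi : i ≠ 0) : K.ExactAt i := by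
  obtain hi | hi := hi.lt_or_gt
  · exact ExactAt.of_isZero ((r i).isZero hi)
  · obtain ⟨i, rfl⟩ : ∃ k, i = k + 1 := ⟨i - 1, by simp⟩
    rw [exactAt_iff' _ i (i + 1) (i + 1 + 1) (by simp) (by simp),
      ShortComplex.exact_iff_exact_up_to_refinements]
    intro W x hx
    have := ((r i).shortExact (by lia)).epi_g
    have hE := exact_ι_d r hK (i + 1) (by lia)
    have hm := (r (i + 1)).isPureMono_ι.mono
    obtain ⟨W', p, hp, z, hz⟩ := surjective_up_to_refinements_of_epi (r i).π
      (hE.lift (x : W ⟶ K.X (i + 1)) hx)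
    refine ⟨W', p, hp, z, ?_⟩
    change p ≫ x = z ≫ K.d i (i + 1)
    rw [hK, ← reassoc_of% hz]
    exact congrArg (p ≫ ·) (hE.lift_f _ _).symm

lemma isCEResolution_of_row : IsCEResolution (S 0).M K := by
  have hd : ∀ k, (r 0).ι ≫ K.d 0 k = 0 := fun k => by
    by_cases hk : 0 + 1 = k
    · subst hk
      exact ι_comp_d r hK 0
    · rw [K.shape _ _ hk, comp_zero]
  have hm := (r 0).isPureMono_ι
  have := hm.mono
  refine ⟨fun i => (r i).isZero, fun i => (r i).isRelativelyInjective, fun i => ?_,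
    mkHomFromSingle (r 0).ι (fun k _ => hd k), ?_, fun i => ?_⟩
  · by_cases hi : 0 ≤ i
    · exact ⟨_, (r i).π, (r (i + 1)).ι, ⟨_, _, _, (r i).isPureMono_ι.isPureShortExact _ _
        ((r i).shortExact hi)⟩, (r (i + 1)).isPureMono_ι, (hK i).symm⟩
    · exact isPure_of_isZero _ ((r i).isZero (by lia))
  · rw [quasiIso_iff]
    intro i
    by_cases hi : i = 0
    · subst hi
      -- Since the neighbouring terms vanish, this reduces to exactness of 0 → (S 0).M → K^0 → K^1.
      rw [quasiIsoAt_iff' _ (-1) 0 (0 + 1) (by simp) (by simp),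
        ShortComplex.quasiIso_iff_of_zeros]
      · have hf : (mkHomFromSingle (r 0).ι (fun k _ => hd k)).f 0 =
            (singleObjXSelf (ComplexShape.up ℤ) 0 (S 0).M).hom ≫ (r 0).ι := by simp
        have hmono : Mono ((mkHomFromSingle (r 0).ι (fun k _ => hd k)).f 0) := by
          rw [hf]
          infer_instance
        refine ⟨?_, hmono⟩
        exact exact_of_eq_iso_hom_comp (singleObjXSelf (ComplexShape.up ℤ) 0 (S 0).M) hf _
          (exact_ι_d r hK 0 le_rfl)
      · exact (isZero_single_obj_X (ComplexShape.up ℤ) 0 (S 0).M (-1) (by lia)).eq_of_src _ _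
      · exact (isZero_single_obj_X (ComplexShape.up ℤ) 0 (S 0).M (0 + 1) (by lia)).eq_of_tgt _ _
      · exact ((r (-1)).isZero (by lia)).eq_of_src _ _
    · rw [quasiIsoAt_iff_exactAt _ _ (exactAt_single_obj _ _ _ _ hi)]
      exact exactAt_of_row r hK i hi
  · by_cases hi : i = 0
    · subst hi
      rw [mkHomFromSingle_f]
      exact (isPureMono_of_quasiIso _).comp hm
    · exact isPureMono_of_isZero _ (isZero_single_obj_X _ _ _ _ hi)

/-- The morphism from `J` to the intermediate resolution. -/
@[simps]
def rowG : J ⟶ K where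
  f i := (r i).g
  comm' i j hij := by
    obtain rfl : i + 1 = j := hij
    rw [hK, reassoc_of% (r i).g_π, (r (i + 1)).φ_ι, toCycles_i_assoc]

/-- The morphism from the intermediate resolution to `J'`. -/
@[simps]
def rowH : K ⟶ J' where
  f i := (r i).h
  comm' i j hij := by
    obtain rfl : i + 1 = j := hij
    rw [hK, Category.assoc, (r (i + 1)).ι_h, (r i).π_ψ]

lemma rowG_comp_rowH : rowG r hK ≫ rowH r hK = fhat := by
  ext1 i
  simp [(r i).g_h]

/-- Z^0(K) is `(S 0).M`, and the initial stage was chosen with `ψ` the inclusion of Z^0(J'), so the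
induced map is the identity up to this identification. -/
lemma isIso_cyclesMap_rowH {φ : J.cycles 0 ⟶ J'.cycles 0} {h₁ h₂ h₃ h₄}
    (hS : S 0 = ⟨J'.cycles 0, h₁, φ, h₂, J'.iCycles 0, h₃, h₄⟩) :
    IsIso (cyclesMap (rowH r hK) 0) := by
  have hm := (r 0).isPureMono_ι.mono
  let l : (S 0).M ⟶ K.cycles 0 := K.liftCycles (r 0).ι (0 + 1) (by simp) (ι_comp_d r hK 0)
  have hE := exact_ι_d r hK 0 le_rfl
  let y : K.cycles 0 ⟶ (S 0).M := hE.lift (K.iCycles 0) (K.iCycles_d 0 (0 + 1))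
  have hy : y ≫ (r 0).ι = K.iCycles 0 := hE.lift_f _ _
  have hl : l ≫ K.iCycles 0 = (r 0).ι := K.liftCycles_i _ _ _ _
  have : IsIso l := ⟨y, by rw [← cancel_mono (r 0).ι]; simp [hy, hl],
    by rw [← cancel_mono (K.iCycles 0)]; simp [hy, hl]⟩
  have h : (l ≫ cyclesMap (rowH r hK) 0) ≫ J'.iCycles 0 = (S 0).ψ := by
    rw [Category.assoc, cyclesMap_i, reassoc_of% hl]
    exact (r 0).ι_h
  have : IsIso (l ≫ cyclesMap (rowH r hK) 0) := by
    have aux : ∀ (T : Stage fhat 0), T = ⟨J'.cycles 0, h₁, φ, h₂, J'.iCycles 0, h₃, h₄⟩ →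
        ∀ x : T.M ⟶ J'.cycles 0, x ≫ J'.iCycles 0 = T.ψ → IsIso x := by
      rintro _ rfl x hx
      have : x = 𝟙 _ := by
        rw [← cancel_mono (J'.iCycles 0), hx, Category.id_comp]
      rw [this]
      infer_instance
    exact aux _ hS _ h
  exact IsIso.of_isIso_comp_left l _

end Assembly

lemma quasiIso_cyclesMap_zero (fhat : J ⟶ J') (hJ : IsZero (J.X (-1))) (hJ' : IsZero (J'.X (-1)))
    (h : QuasiIso (homologyMap fhat 0)) : QuasiIso (cyclesMap fhat 0) := by
  have := J.isIso_homologyπ (-1) 0 (by simp) (hJ.eq_of_src _ _)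
  have := J'.isIso_homologyπ (-1) 0 (by simp) (hJ'.eq_of_src _ _)
  have : QuasiIso (cyclesMap fhat 0 ≫ J'.homologyπ 0) := by
    rw [← homologyπ_naturality]
    infer_instance
  exact quasiIso_of_comp_right _ (J'.homologyπ 0)

theorem exists_factorization [EnoughInjectives A] (hJ : IsCEResolution X J)
    (hJ0 : IsFirstQuadrant J) (hJ' : IsCEResolution X' J') (hJ0' : IsFirstQuadrant J')
    (fhat : J ⟶ J') (hf : QuasiIso (homologyMap fhat 0)) :
    ∃ (K : DoubleComplex A) (g : J ⟶ K) (h : K ⟶ J'),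
      ceResolutions A K ∧ IsRowwiseHomotopism g ∧ IsDoubleHomotopism h ∧ g ≫ h = fhat := by
  have hZ : ∀ j < 0, IsZero ((J'.cycles 0).X j) := fun j hj => by
    rw [IsZero.iff_id_eq_zero, ← cancel_mono ((J'.iCycles 0).f j)]
    exact (hJ0' 0 j (Or.inr hj)).eq_of_tgt _ _
  let S₀ : Stage fhat 0 :=
    { M := J'.cycles 0
      isZero_M := hZ
      φ := cyclesMap fhat 0
      quasiIso_φ := quasiIso_cyclesMap_zero fhat (hJ.isZero_X _ (by lia)) (hJ'.isZero_X _ (by lia))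
        hf
      ψ := J'.iCycles 0
      ψ_d := by simp
      φ_ψ := by simp }
  obtain ⟨S, hS₀, hS⟩ := exists_stages hJ hJ0 hJ' S₀
  obtain ⟨K, r, hK⟩ := exists_cochainComplex hS
  have hCE := isCEResolution_of_row r hK
  have := isIso_cyclesMap_rowH r hK hS₀
  refine ⟨K, rowG r hK, rowH r hK, ⟨fun i j hij => ?_, _, hCE⟩, fun i => ?_,
    isDoubleHomotopism_of_isIso_cyclesMap _ hCE hJ', rowG_comp_rowH r hK⟩
  · obtain hi | hj := hij
    · exact (HomologicalComplex.eval A _ j).map_isZero ((r i).isZero hi)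
    · exact (r i).isZero_X j hj
  · have := (r i).quasiIso_g
    exact isHomotopism_of_quasiIso (r i).g (hJ.isRelativelyInjective i)
      (fun j hj => hJ0 i j (Or.inr hj)) (r i).isRelativelyInjective (r i).isZero_X

end CartanEilenberg

end

theorem proposition2p11 {A : Type u} [Category.{v} A] [Abelian A] [EnoughInjectives A]
    {X X' : CochainComplex A ℤ} [X.IsStrictlyGE 0] [X'.IsStrictlyGE 0]
    (f : X ⟶ X') (hf : QuasiIso f)
    {J J' : CartanEilenberg.DoubleComplex A} (fhat : J ⟶ J')
    (hfhat : CartanEilenberg.IsCEResolutionOfMorphism f fhat) :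
    ∃ (K : CartanEilenberg.DoubleComplex A) (g : J ⟶ K) (h : K ⟶ J'),
      CartanEilenberg.ceResolutions A K ∧
        CartanEilenberg.IsRowwiseHomotopism g ∧ CartanEilenberg.IsDoubleHomotopism h ∧
        g ≫ h = fhat := by
  obtain ⟨⟨hJ0, hJ⟩, ⟨hJ0', hJ'⟩, ⟨e⟩⟩ := hfhat
  -- Being a quasi-isomorphism is invariant under isomorphism of arrows, so it passes from `f` to
  -- the map induced on zeroth homology.
  exact CartanEilenberg.exists_factorization hJ hJ0 hJ' hJ0' fhat
    (((HomologicalComplex.quasiIso A (ComplexShape.up ℤ)).arrow_mk_iso_iff e).2 hf)
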